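/- A \emph{generalized probabilistic Cops and Robbers game} $\mathcal G$ consists of a finite set $S$ of states, an initial state $i_0\in S$, a set $F\subseteq S$ of final states, finite action sets $A_c$ (cops) and $A_r$ (robbers), and transition functions $T_c:S\times A_c\times S\to[0,1]$ and $T_r:S\times A_r\times S\to[0,1]$. For every state $s$ and action $a$, the sum $\sum_{s'}T(s,a,s')$ is $0$ or $1$; $a$ is \emph{playable} in $s$ if it is $1$. Every state has a playable action for each player, and $T(s,a,s)=1$ for all $s\in F$ and all actions $a$. A play starts in $i_0$; the cops and the robbers alternately choose an action playable in the current state, the cops first, and the next state is drawn according to the corresponding transition function. A turn is one move of the cops followed by one move of the robbers. The robbers are \emph{captured} when a state of $F$ is reached. All strategies are deterministic. A general strategy depends on the history of the play, a memoryless strategy only on the current state, and a finite horizon strategy on the current state and the number of turns that remain. Let $p(\sigma,\tau)$ and $p_n(\sigma,\tau)$ be the probabilities that the robbers are captured at some time, respectively within the first $n$ turns, when the cops follow $\sigma$ and the robbers follow $\tau$. The value of the $n$-turn game $\mathcal G_n$ is $p_n^*=\max_\sigma\min_\tau p_n(\sigma,\tau)$ over finite horizon strategies (with $n$ turns remaining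 at the start), and the value of the infinite game $\mathcal G$ is $p^*_{\mathcal G}=\max_\sigma\min_\tau p(\sigma,\tau)$ over memoryless strategies. \textbf{Proposition.} For every such game $\mathcal G$: (1) $p^*_{\mathcal G}$ is the value of $\mathcal G$ both in memoryless and in general strategies: $\min_\tau\max_\sigma p(\sigma,\tau)=p^*_{\mathcal G}$ over memoryless strategies, and $\sup_\sigma\inf_\tau p(\sigma,\tau)=\inf_\tau\sup_\sigma p(\sigma,\tau)=p^*_{\mathcal G}$ over general strategies. Moreover $\lim_{n\to\infty}p_n^*=p^*_{\mathcal G}$. (2) For every $\varepsilon>0$ there is $N$ such that for all $n\ge N$ the optimal strategies of the cops in $\mathcal G_n$ are $\varepsilon$-optimal in $\mathcal G$. That is: if $\sigma_0$ is a finite horizon strategy of the cops with $p_n(\sigma_0,\tau)\ge p_n^*$ for all finite horizon strategies $\tau$ of the robbers, and $\sigma$ is any general strategy of the cops that plays as $\sigma_0$ during the first $n$ turns, or if $\sigma$ is a general strategy of the cops with $p_n(\sigma,\tau)\ge p_n^*$ for all general strategies $\tau$ of the robbers, then $p(\sigma,\tau)\ge p^*_{\mathcal G}-\varepsilon$ for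 all general strategies $\tau$ of the robbers. -/

import Mathlib

open MeasureTheory ProbabilityTheory Filter Topology

/-- `T` is a transition function on the states `S` with actions `A` and absorbing set `F`:
the entries are in `[0, 1]`, each row `T s a ·` sums to `0` (the action is not playable) or to `1`
(it is playable), some action is playable in each state, and in a state of `F` every
action leaves the state unchanged. -/
structure IsTransitionFunction {S A : Type*} [Fintype S] (F : Set S) (T : S → A → S → ℝ) :
    Prop where
  mem_Icc : ∀ s a s', T s a s' ∈ Set.Icc (0 : ℝ) 1
  sum_eq : ∀ s a, ∑ s', T s a s' = 0 ∨ ∑ s', T s a s' = 1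
  exists_playable : ∀ s, ∃ a, ∑ s', T s a s' = 1
  absorbing : ∀ s ∈ F, ∀ a, T s a s = 1

/-- A generalized probabilistic Cops and Robbers game on the finite state set `S`, with finite
action sets `Ac` for the cops and `Ar` for the robbers. (Nothing depends on `S` being written as
a product of positions and further data, so any finite set of states is allowed.) -/
structure GPCR (S Ac Ar : Type*) [Fintype S] where
  /-- the initial state -/
  init : S
  /-- the final states, winning for the cops -/
  final : Set S
  /-- the transition function of the cops -/
  Tc : S → Ac → S → ℝ
  /-- the transition function of the robbers -/
  Tr : S → Ar → S → ℝ
  isTransition_cop : IsTransitionFunction final Tc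
  isTransition_rob : IsTransitionFunction final Tr

namespace GPCR

variable {S Ac Ar : Type*} [Fintype S]

/-- The actions of the cops that are playable in state `s`. -/
def CopAct (G : GPCR S Ac Ar) (s : S) : Type _ := {a : Ac // ∑ s', G.Tc s a s' = 1}

/-- The actions of the robbers that are playable in state `s`. -/
def RobAct (G : GPCR S Ac Ar) (s : S) : Type _ := {a : Ar // ∑ s', G.Tr s a s' = 1}

instance [Finite Ac] (G : GPCR S Ac Ar) (s : S) : Finite (G.CopAct s) :=
  inferInstanceAs (Finite {a : Ac // ∑ s', G.Tc s a s' = 1})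

instance [Finite Ar] (G : GPCR S Ac Ar) (s : S) : Finite (G.RobAct s) :=
  inferInstanceAs (Finite {a : Ar // ∑ s', G.Tr s a s' = 1})

/-- One entry `s a` of a play `s₀ a₀ s₁ a₁ s₂ a₂ …`: a state together with an action, of the cops
or of the robbers, that is playable in that state. -/
def Step (G : GPCR S Ac Ar) : Type _ := Σ s : S, G.CopAct s ⊕ G.RobAct s

instance [Finite Ac] [Finite Ar] (G : GPCR S Ac Ar) : Finite G.Step :=
  inferInstanceAs (Finite (Σ s : S, G.CopAct s ⊕ G.RobAct s))

instance (G : GPCR S Ac Ar) : MeasurableSpace G.Step := ⊤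

instance (G : GPCR S Ac Ar) : DiscreteMeasurableSpace G.Step := ⟨fun _ ↦ trivial⟩

lemma sum_ofReal_eq_one {A : Type*} {F : Set S} {T : S → A → S → ℝ}
    (hT : IsTransitionFunction F T) {s : S} {a : A} (h : ∑ s', T s a s' = 1) :
    ∑ s', ENNReal.ofReal (T s a s') = 1 := by
  rw [← ENNReal.ofReal_sum_of_nonneg fun s' _ ↦ (hT.mem_Icc s a s').1, h, ENNReal.ofReal_one]

/-- The distribution of the next state after the state and action `x`: the one given by `Tc` for
an action of the cops, by `Tr` for an action of the robbers. -/
noncomputable def nextState (G : GPCR S Ac Ar) (x : G.Step) : PMF S :=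
  match x with
  | ⟨s, .inl a⟩ => PMF.ofFintype (fun s' ↦ ENNReal.ofReal (G.Tc s a.1 s'))
      (sum_ofReal_eq_one G.isTransition_cop a.2)
  | ⟨s, .inr a⟩ => PMF.ofFintype (fun s' ↦ ENNReal.ofReal (G.Tr s a.1 s'))
      (sum_ofReal_eq_one G.isTransition_rob a.2)

/-! ### Strategies

A history `s₀ a₀ … s_{j-1} a_{j-1} s_j` is the sequence of its first `j` entries together with
the current state `s_j`. The cops move at the even times `j = 2 t` and the robbers at the odd
times `j = 2 t + 1`, where `t` is the number of the current turn. -/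

/-- General (history-dependent, deterministic) strategies of the cops. Only the values at even
times `j` are ever used. -/
abbrev CopStrategy (G : GPCR S Ac Ar) : Type _ := (j : ℕ) → (Fin j → G.Step) → (s : S) → G.CopAct s

/-- General (history-dependent, deterministic) strategies of the robbers. Only the values at odd
times `j` are ever used. -/
abbrev RobStrategy (G : GPCR S Ac Ar) : Type _ := (j : ℕ) → (Fin j → G.Step) → (s : S) → G.RobAct s

/-- Memoryless strategies of the cops. -/
abbrev CopMemoryless (G : GPCR S Ac Ar) : Type _ := (s : S) → G.CopAct s

/-- Memoryless strategies of the robbers. -/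
abbrev RobMemoryless (G : GPCR S Ac Ar) : Type _ := (s : S) → G.RobAct s

/-- Finite horizon strategies of the cops: they depend on the current state and on the number of
turns that remain, the current one included. -/
abbrev CopFiniteHorizon (G : GPCR S Ac Ar) : Type _ := (s : S) → ℕ → G.CopAct s

/-- Finite horizon strategies of the robbers. -/
abbrev RobFiniteHorizon (G : GPCR S Ac Ar) : Type _ := (s : S) → ℕ → G.RobAct s

/-- A memoryless strategy of the cops as a general strategy. -/
def CopMemoryless.toGeneral {G : GPCR S Ac Ar} (σ : G.CopMemoryless) : G.CopStrategy :=
  fun _ _ s ↦ σ s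

/-- A memoryless strategy of the robbers as a general strategy. -/
def RobMemoryless.toGeneral {G : GPCR S Ac Ar} (τ : G.RobMemoryless) : G.RobStrategy :=
  fun _ _ s ↦ τ s

/-- A finite horizon strategy of the cops, played in the game with `n` turns: at times `2 t` and
`2 t + 1` there remain `n - t` turns. (After the `n` turns the second argument stays `0`.) -/
def CopFiniteHorizon.toGeneral {G : GPCR S Ac Ar} (σ : G.CopFiniteHorizon) (n : ℕ) :
    G.CopStrategy :=
  fun j _ s ↦ σ s (n - j / 2)

/-- A finite horizon strategy of the robbers, played in the game with `n` turns. -/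
def RobFiniteHorizon.toGeneral {G : GPCR S Ac Ar} (τ : G.RobFiniteHorizon) (n : ℕ) :
    G.RobStrategy :=
  fun j _ s ↦ τ s (n - j / 2)

/-! ### The law of the play -/

/-- The entry at time `j` of the play, given the earlier entries and the state at time `j`: the
player whose turn it is chooses the action. -/
def entry (G : GPCR S Ac Ar) (σ : G.CopStrategy) (τ : G.RobStrategy) (j : ℕ)
    (past : Fin j → G.Step) (s : S) : G.Step :=
  ⟨s, if Even j then .inl (σ j past s) else .inr (τ j past s)⟩

/-- The transition of the play from its entries at times `0, …, j` to its entry at time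
`j + 1`. -/
noncomputable def playKernel [Finite Ac] [Finite Ar] (G : GPCR S Ac Ar) (σ : G.CopStrategy)
    (τ : G.RobStrategy) (j : ℕ) : Kernel ((i : Finset.Iic j) → G.Step) G.Step where
  toFun h := ((G.nextState (h ⟨j, Finset.mem_Iic.2 le_rfl⟩)).map
    (G.entry σ τ (j + 1) fun i ↦ h ⟨i, Finset.mem_Iic.2 (Nat.lt_succ_iff.1 i.2)⟩)).toMeasure
  measurable' := .of_discrete

instance [Finite Ac] [Finite Ar] (G : GPCR S Ac Ar) (σ : G.CopStrategy) (τ : G.RobStrategy)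
    (j : ℕ) : IsMarkovKernel (G.playKernel σ τ j) :=
  ⟨fun h ↦ PMF.toMeasure.isProbabilityMeasure _⟩

/-- The law of the infinite play that starts in the initial state, when the cops follow `σ` and
the robbers follow `τ`. -/
noncomputable def playMeasure [Finite Ac] [Finite Ar] (G : GPCR S Ac Ar) (σ : G.CopStrategy)
    (τ : G.RobStrategy) : Measure (ℕ → G.Step) :=
  Kernel.trajMeasure (X := fun _ ↦ G.Step)
    (Measure.dirac (G.entry σ τ 0 Fin.elim0 G.init)) (G.playKernel σ τ)

/-- The probability of capture within the first `n` turns, i.e. within the first `2 n` moves. -/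
noncomputable def captureWithin [Finite Ac] [Finite Ar] (G : GPCR S Ac Ar) (n : ℕ)
    (σ : G.CopStrategy) (τ : G.RobStrategy) : ℝ :=
  (G.playMeasure σ τ).real {h | ∃ j ≤ 2 * n, (h j).1 ∈ G.final}

/-- The probability of capture in the infinite play. -/
noncomputable def capture [Finite Ac] [Finite Ar] (G : GPCR S Ac Ar)
    (σ : G.CopStrategy) (τ : G.RobStrategy) : ℝ :=
  (G.playMeasure σ τ).real {h | ∃ j, (h j).1 ∈ G.final}

/-! ### Values and optimal strategies -/

/-- The value `p_n^*` of the game with `n` turns: max-min over finite horizon strategies. -/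
noncomputable def finiteValue [Finite Ac] [Finite Ar] (G : GPCR S Ac Ar) (n : ℕ) : ℝ :=
  ⨆ σ : G.CopFiniteHorizon, ⨅ τ : G.RobFiniteHorizon,
    G.captureWithin n (σ.toGeneral n) (τ.toGeneral n)

/-- The value `p_G^*` of the infinite game: max-min over memoryless strategies. -/
noncomputable def value [Finite Ac] [Finite Ar] (G : GPCR S Ac Ar) : ℝ :=
  ⨆ σ : G.CopMemoryless, ⨅ τ : G.RobMemoryless, G.capture σ.toGeneral τ.toGeneral

/-- A finite horizon strategy of the cops is optimal in the game with `n` turns: it guarantees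
the probability `p_n^*` of capture within `n` turns. -/
def CopFiniteHorizon.IsOptimal [Finite Ac] [Finite Ar] {G : GPCR S Ac Ar}
    (σ : G.CopFiniteHorizon) (n : ℕ) : Prop :=
  ∀ τ : G.RobFiniteHorizon,
    G.finiteValue n ≤ G.captureWithin n (σ.toGeneral n) (τ.toGeneral n)

/-- A general strategy of the cops is optimal in the game with `n` turns. -/
def IsOptimalWithin [Finite Ac] [Finite Ar] (G : GPCR S Ac Ar) (n : ℕ) (σ : G.CopStrategy) :
    Prop :=
  ∀ τ : G.RobStrategy, G.finiteValue n ≤ G.captureWithin n σ τ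

/-- A general strategy of the cops plays as the finite horizon strategy `σ₀` during the `n` turns
of the game with `n` turns, and arbitrarily afterwards. -/
def Extends {G : GPCR S Ac Ar} (σ : G.CopStrategy) (σ₀ : G.CopFiniteHorizon) (n : ℕ) : Prop :=
  ∀ t < n, ∀ (past : Fin (2 * t) → G.Step) (s : S), σ (2 * t) past s = σ₀ s (n - t)

/-- A general strategy of the cops is `ε`-optimal in the infinite game: against every strategy of
the robbers, the probability of capture is at least the value of the game minus `ε`. -/
def IsEpsOptimal [Finite Ac] [Finite Ar] (G : GPCR S Ac Ar) (ε : ℝ) (σ : G.CopStrategy) : Prop :=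
  ∀ τ : G.RobStrategy, G.value - ε ≤ G.capture σ τ

end GPCR

/-!
The game is solved by value iteration. A turn is described by the operator `copVal`, which sends a
function `f` of the state to the best average of `f` that the cops can guarantee after one more
turn. Its iterates on the indicator function of the final states are the values `valueIter k` of the
games with `k` turns. They increase, since final states are never left, and their limit `valueLim`
is a fixed point of `copVal` by continuity.

The link with the law of the play is the one-step formula `expect_succ` for the expected value of a
function of the current state; with it, functions that the operators decrease or increase turn into
super- and submartingales along the play. This bounds the probability of capture within `n` turns
against arbitrary histories: a finite horizon strategy `σ₀` guarantees exactly `guarantee σ₀ n`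
(`iInf_captureWithin`), whose maximum over `σ₀` is `valueIter n` (`finiteValue_eq`). In particular
some best answer to a finite horizon strategy is itself a finite horizon strategy.

In the infinite game, the robbers hold the probability of capture down to `valueLim` by always
minimizing the average of `valueLim` over the next state (`exists_capture_le_valueLim`). For the
cops, maximizing this average is not enough, since the play might then circle forever among states
of the same value. The `attractor` consists of the states from which actions that are optimal
for `valueLim` lead to a final state with positive probability in a bounded number of turns. It
contains every state of positive value (`exists_mem_attractor`), so the cops can play optimally and
make progress at the same time, and such a memoryless strategy guarantees `valueLim`
(`exists_valueLim_le_capture`).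

These two memoryless strategies form a saddle point among all general strategies, which yields all
the max-min and min-max equalities at once. Finally, a strategy that is optimal for `n` turns
captures with probability at least `valueIter n` at the initial state, which is close to the value
of the infinite game for large `n`.
-/

namespace GPCR

/-! ### Averages over the next state -/

section Average

variable {S : Type*} [Fintype S] {p f g : S → ℝ} {c : ℝ}

lemma dotProduct_le_dotProduct_of_support (hp : p ∈ stdSimplex ℝ S)
    (h : ∀ s, 0 < p s → f s ≤ g s) : p ⬝ᵥ f ≤ p ⬝ᵥ g := by
  refine Finset.sum_le_sum fun s _ ↦ ?_
  rcases (hp.1 s).eq_or_lt with h0 | h0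
  · simp [← h0]
  · exact mul_le_mul_of_nonneg_left (h s h0) h0.le

lemma dotProduct_const_of_mem (hp : p ∈ stdSimplex ℝ S) (c : ℝ) : p ⬝ᵥ (fun _ ↦ c) = c := by
  simp only [dotProduct, ← Finset.sum_mul, hp.2, one_mul]

lemma dotProduct_le_of_support (hp : p ∈ stdSimplex ℝ S) (h : ∀ s, 0 < p s → f s ≤ c) :
    p ⬝ᵥ f ≤ c :=
  (dotProduct_le_dotProduct_of_support hp h).trans_eq (dotProduct_const_of_mem hp c)

lemma dotProduct_lt_of_support (hp : p ∈ stdSimplex ℝ S) (h : ∀ s, 0 < p s → f s ≤ c)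
    {s₀ : S} (h₀ : 0 < p s₀) (hlt : f s₀ < c) : p ⬝ᵥ f < c := by
  rw [← dotProduct_const_of_mem hp c]
  refine Finset.sum_lt_sum (fun s _ ↦ ?_) ⟨s₀, Finset.mem_univ _, mul_lt_mul_of_pos_left hlt h₀⟩
  rcases (hp.1 s).eq_or_lt with h0 | h0
  · simp [← h0]
  · exact mul_le_mul_of_nonneg_left (h s h0) h0.le

/-- The average over a distribution concentrated in `s` is the value at `s`. -/
lemma dotProduct_eq_of_apply_eq_one (hp : p ∈ stdSimplex ℝ S) {s : S} (hs : p s = 1)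
    (f : S → ℝ) : p ⬝ᵥ f = f s := by
  classical
  have h0 : ∀ x, x ≠ s → p x = 0 := by
    intro x hx
    have h1 := Finset.add_sum_erase Finset.univ p (Finset.mem_univ s)
    rw [hp.2, hs] at h1
    have h2 : ∑ x ∈ Finset.univ.erase s, p x = 0 := by linarith
    exact (Finset.sum_eq_zero_iff_of_nonneg fun y _ ↦ hp.1 y).1 h2 x (by simp [hx])
  rw [dotProduct, Finset.sum_eq_single s (fun x _ hx ↦ by simp [h0 x hx]) (by simp), hs, one_mul]

end Average

variable {S Ac Ar : Type*} [Fintype S]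

lemma Tc_mem (G : GPCR S Ac Ar) {s : S} (a : G.CopAct s) : G.Tc s a.1 ∈ stdSimplex ℝ S :=
  ⟨fun s' ↦ (G.isTransition_cop.mem_Icc s a.1 s').1, a.2⟩

lemma Tr_mem (G : GPCR S Ac Ar) {s : S} (b : G.RobAct s) : G.Tr s b.1 ∈ stdSimplex ℝ S :=
  ⟨fun s' ↦ (G.isTransition_rob.mem_Icc s b.1 s').1, b.2⟩

instance (G : GPCR S Ac Ar) (s : S) : Nonempty (G.CopAct s) :=
  let ⟨a, ha⟩ := G.isTransition_cop.exists_playable s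
  ⟨⟨a, ha⟩⟩

instance (G : GPCR S Ac Ar) (s : S) : Nonempty (G.RobAct s) :=
  let ⟨b, hb⟩ := G.isTransition_rob.exists_playable s
  ⟨⟨b, hb⟩⟩

lemma nextState_mem_stdSimplex (G : GPCR S Ac Ar) (x : G.Step) :
    (fun s' ↦ (G.nextState x s').toReal) ∈ stdSimplex ℝ S := by
  refine ⟨fun _ ↦ ENNReal.toReal_nonneg, ?_⟩
  rw [← ENNReal.toReal_sum fun s' _ ↦ PMF.apply_ne_top _ _, ← tsum_fintype (L := .unconditional S),
    (G.nextState x).tsum_coe, ENNReal.toReal_one]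

lemma nextState_apply_self {G : GPCR S Ac Ar} {x : G.Step} (hx : x.1 ∈ G.final) :
    (G.nextState x x.1).toReal = 1 := by
  rcases x with ⟨s, a | b⟩
  · simp [nextState, G.isTransition_cop.absorbing s hx a.1]
  · simp [nextState, G.isTransition_rob.absorbing s hx b.1]

/-- The indicator function of the final states. -/
noncomputable def finalInd (G : GPCR S Ac Ar) : S → ℝ := G.final.indicator 1

lemma nextState_entry_of_even {G : GPCR S Ac Ar} {j : ℕ} (hj : Even j)
    {σ : G.CopStrategy} {τ : G.RobStrategy} (past : Fin j → G.Step) (s : S) :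
    (fun s' ↦ (G.nextState (G.entry σ τ j past s) s').toReal) = G.Tc s (σ j past s).1 := by
  ext s'
  simp only [entry, hj, if_true, nextState, PMF.ofFintype_apply]
  exact ENNReal.toReal_ofReal ((G.Tc_mem _).1 s')

lemma nextState_entry_of_not_even {G : GPCR S Ac Ar} {j : ℕ} (hj : ¬ Even j)
    {σ : G.CopStrategy} {τ : G.RobStrategy} (past : Fin j → G.Step) (s : S) :
    (fun s' ↦ (G.nextState (G.entry σ τ j past s) s').toReal) = G.Tr s (τ j past s).1 := by
  ext s'
  simp only [entry, hj, if_false, nextState, PMF.ofFintype_apply]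
  exact ENNReal.toReal_ofReal ((G.Tr_mem _).1 s')

/-! ### The expected value of a function of the current state -/

section Play

variable [Finite Ac] [Finite Ar] (G : GPCR S Ac Ar) (σ : G.CopStrategy) (τ : G.RobStrategy)

instance : IsProbabilityMeasure (G.playMeasure σ τ) := by
  unfold playMeasure; infer_instance

/-- The expected value of `f` at the state at time `j` of the play. -/
noncomputable def expect (j : ℕ) (f : S → ℝ) : ℝ := ∫ h, f (h j).1 ∂G.playMeasure σ τ

lemma integrable_comp_apply (j : ℕ) (f : G.Step → ℝ) :
    Integrable (fun h ↦ f (h j)) (G.playMeasure σ τ) := by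
  have hm : Measurable fun h : ℕ → G.Step ↦ h j := measurable_pi_apply j
  have := Measure.isProbabilityMeasure_map (μ := G.playMeasure σ τ) hm.aemeasurable
  have hf : Integrable f ((G.playMeasure σ τ).map fun h ↦ h j) := .of_finite
  exact hf.comp_measurable hm

lemma map_prodMk_frestrictLe_playMeasure (j : ℕ) :
    (G.playMeasure σ τ).map (fun h ↦ (Preorder.frestrictLe (π := fun _ ↦ G.Step) j h, h (j + 1))) =
      (G.playMeasure σ τ).map (Preorder.frestrictLe j) ⊗ₘ G.playKernel σ τ j :=
  Kernel.map_frestrictLe_trajMeasure_compProd_eq_map_trajMeasure.symm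

/-- Almost every play starts with the entry that the cops choose in the initial state. -/
lemma ae_zero_eq_entry :
    ∀ᵐ h ∂G.playMeasure σ τ, h 0 = G.entry σ τ 0 Fin.elim0 G.init := by
  have key : (G.playMeasure σ τ).map (Preorder.frestrictLe 0) =
      Measure.dirac fun _ ↦ G.entry σ τ 0 Fin.elim0 G.init := by
    rw [playMeasure, Kernel.trajMeasure, Measure.map_comp _ _ (by fun_prop),
      Kernel.traj_map_frestrictLe, Kernel.partialTraj_self, Measure.id_comp,
      Measure.map_dirac' (by fun_prop)]
    rfl
  have h1 : ∀ᵐ x ∂(G.playMeasure σ τ).map (Preorder.frestrictLe 0),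
      x ⟨0, by simp⟩ = G.entry σ τ 0 Fin.elim0 G.init := by
    rw [key, ae_dirac_iff (.of_discrete)]
  exact ae_of_ae_map (Preorder.measurable_frestrictLe 0).aemeasurable h1

/-- In almost every play, the state at time `j + 1` is one that can follow the entry at time `j`,
and the entry at time `j + 1` is the one that the strategies choose in that state. -/
lemma ae_exists_eq_entry_succ (j : ℕ) :
    ∀ᵐ h ∂G.playMeasure σ τ, ∃ s' ∈ (G.nextState (h j)).support,
      h (j + 1) = G.entry σ τ (j + 1) (fun i ↦ h i) s' := by
  have h1 : ∀ᵐ x ∂(G.playMeasure σ τ).map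
      (fun h ↦ (Preorder.frestrictLe (π := fun _ ↦ G.Step) j h, h (j + 1))),
      ∃ s' ∈ (G.nextState (x.1 ⟨j, Finset.mem_Iic.2 le_rfl⟩)).support,
        x.2 = G.entry σ τ (j + 1)
          (fun i ↦ x.1 ⟨i, Finset.mem_Iic.2 (Nat.lt_succ_iff.1 i.2)⟩) s' := by
    rw [map_prodMk_frestrictLe_playMeasure, Measure.ae_compProd_iff .of_discrete]
    refine ae_of_all _ fun x ↦ ?_
    change ∀ᵐ y ∂(PMF.map _ _).toMeasure, _
    rw [ae_iff, PMF.toMeasure_apply_eq_zero_iff _ .of_discrete, Set.disjoint_left]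
    intro y hy
    obtain ⟨s', hs', rfl⟩ := (PMF.mem_support_map_iff _ _ _).1 hy
    exact not_not.2 ⟨s', hs', rfl⟩
  exact ae_of_ae_map ((Preorder.measurable_frestrictLe j).prodMk
    (measurable_pi_apply (j + 1))).aemeasurable h1

/-- In almost every play, each entry is the one that the strategies choose. -/
lemma ae_eq_entry (j : ℕ) :
    ∀ᵐ h ∂G.playMeasure σ τ, h j = G.entry σ τ j (fun i ↦ h i) (h j).1 := by
  cases j with
  | zero =>
    filter_upwards [G.ae_zero_eq_entry σ τ] with h hh
    rw [Subsingleton.elim (fun i : Fin 0 ↦ h i) Fin.elim0, hh]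
    rfl
  | succ j =>
    filter_upwards [G.ae_exists_eq_entry_succ σ τ j] with h ⟨s', _, hs'⟩
    rw [hs']
    rfl

lemma expect_zero (f : S → ℝ) : G.expect σ τ 0 f = f G.init := by
  rw [expect, integral_congr_ae (g := fun _ ↦ f G.init)]
  · simp
  · filter_upwards [G.ae_zero_eq_entry σ τ] with h hh
    rw [hh]
    rfl

lemma expect_succ (j : ℕ) (f : S → ℝ) :
    G.expect σ τ (j + 1) f =
      ∫ h, (fun s' ↦ (G.nextState (h j) s').toReal) ⬝ᵥ f ∂G.playMeasure σ τ := by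
  let : MeasurableSpace S := ⊤
  have : IsProbabilityMeasure ((G.playMeasure σ τ).map
      (Preorder.frestrictLe (π := fun _ ↦ G.Step) j)) :=
    Measure.isProbabilityMeasure_map (by fun_prop)
  have h1 : G.expect σ τ (j + 1) f = ∫ x, f x.2.1 ∂(G.playMeasure σ τ).map
      (fun h ↦ (Preorder.frestrictLe (π := fun _ ↦ G.Step) j h, h (j + 1))) := by
    rw [integral_map (by fun_prop) (Measurable.of_discrete).aestronglyMeasurable, expect]
  rw [h1, map_prodMk_frestrictLe_playMeasure, Measure.integral_compProd .of_finite,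
    integral_map (by fun_prop) (Measurable.of_discrete).aestronglyMeasurable]
  refine integral_congr_ae (ae_of_all _ fun h ↦ ?_)
  change ∫ y : G.Step, f y.1 ∂(PMF.map _ _).toMeasure = _
  rw [← PMF.toMeasure_map (hf := Measurable.of_discrete),
    integral_map Measurable.of_discrete.aemeasurable Measurable.of_discrete.aestronglyMeasurable,
    PMF.integral_eq_sum]
  rfl

/-- A final state is never left. -/
lemma ae_final_succ (j : ℕ) :
    ∀ᵐ h ∂G.playMeasure σ τ, (h j).1 ∈ G.final → (h (j + 1)).1 ∈ G.final := by
  classical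
  filter_upwards [G.ae_exists_eq_entry_succ σ τ j] with h ⟨s', hs', hh⟩ hF
  -- Averaging the indicator function of `s'` shows that `s'` has positive probability only if it
  -- is the current state.
  have h1 := dotProduct_eq_of_apply_eq_one (G.nextState_mem_stdSimplex (h j))
    (nextState_apply_self hF) (Pi.single s' 1)
  rw [dotProduct_single_one] at h1
  have h2 : s' = (h j).1 := by
    by_contra hne
    rw [Pi.single_eq_of_ne (Ne.symm hne), ENNReal.toReal_eq_zero_iff] at h1
    exact h1.elim ((PMF.mem_support_iff _ _).1 hs') (PMF.apply_ne_top _ _)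
  rw [hh]
  change s' ∈ G.final
  exact h2 ▸ hF

/-- As final states are never left, it suffices to look at the state after `n` turns. -/
lemma captureWithin_eq_expect (n : ℕ) :
    G.captureWithin n σ τ = G.expect σ τ (2 * n) G.finalInd := by
  have hmono : ∀ᵐ h ∂G.playMeasure σ τ, ∀ j k, j ≤ k → (h j).1 ∈ G.final → (h k).1 ∈ G.final := by
    filter_upwards [ae_all_iff.2 (G.ae_final_succ σ τ)] with h hh j k hjk hj
    induction k, hjk using Nat.le_induction with
    | base => exact hj
    | succ k _ ih => exact hh k ih
  have hset : MeasurableSet {h : ℕ → G.Step | (h (2 * n)).1 ∈ G.final} :=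
    (MeasurableSet.of_discrete (s := {x : G.Step | x.1 ∈ G.final})).preimage
      (measurable_pi_apply (2 * n))
  calc G.captureWithin n σ τ
      = (G.playMeasure σ τ).real {h | (h (2 * n)).1 ∈ G.final} := by
        refine measureReal_congr ?_
        filter_upwards [hmono] with h hh
        exact propext ⟨fun ⟨j, hj, hF⟩ ↦ hh j _ hj hF, fun hF ↦ ⟨_, le_rfl, hF⟩⟩
    _ = _ := by
        rw [← integral_indicator_one hset]
        rfl

lemma captureWithin_le_capture (n : ℕ) : G.captureWithin n σ τ ≤ G.capture σ τ :=
  measureReal_mono fun _ ⟨j, _, hj⟩ ↦ ⟨j, hj⟩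

lemma tendsto_captureWithin :
    Tendsto (fun n ↦ G.captureWithin n σ τ) atTop (𝓝 (G.capture σ τ)) := by
  have h1 : {h : ℕ → G.Step | ∃ j, (h j).1 ∈ G.final} =
      ⋃ n : ℕ, {h | ∃ j ≤ 2 * n, (h j).1 ∈ G.final} := by
    ext h
    simp only [Set.mem_ofPred_eq, Set.mem_iUnion]
    exact ⟨fun ⟨j, hj⟩ ↦ ⟨j, j, by lia, hj⟩, fun ⟨_, j, _, hj⟩ ↦ ⟨j, hj⟩⟩
  have h2 : Monotone fun n : ℕ ↦ {h : ℕ → G.Step | ∃ j ≤ 2 * n, (h j).1 ∈ G.final} :=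
    fun m n hmn _ ⟨j, hj, hF⟩ ↦ ⟨j, by lia, hF⟩
  have h3 := (ENNReal.tendsto_toReal (measure_ne_top (G.playMeasure σ τ) _)).comp
    (tendsto_measure_iUnion_atTop (μ := G.playMeasure σ τ) h2)
  rw [← h1] at h3
  exact h3

variable {G σ τ}

lemma expect_le_expect_succ {j : ℕ} {f g : S → ℝ}
    (H : ∀ past s, f s ≤ (fun s' ↦ (G.nextState (G.entry σ τ j past s) s').toReal) ⬝ᵥ g) :
    G.expect σ τ j f ≤ G.expect σ τ (j + 1) g := by
  rw [expect_succ]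
  refine integral_mono_ae (G.integrable_comp_apply σ τ j fun x ↦ f x.1)
    (G.integrable_comp_apply σ τ j fun x ↦ (fun s' ↦ (G.nextState x s').toReal) ⬝ᵥ g) ?_
  filter_upwards [G.ae_eq_entry σ τ j] with h hh
  have := H (fun i ↦ h i) (h j).1
  rwa [← hh] at this

lemma expect_succ_le_expect {j : ℕ} {f g : S → ℝ}
    (H : ∀ past s, (fun s' ↦ (G.nextState (G.entry σ τ j past s) s').toReal) ⬝ᵥ g ≤ f s) :
    G.expect σ τ (j + 1) g ≤ G.expect σ τ j f := by
  rw [expect_succ]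
  refine integral_mono_ae (G.integrable_comp_apply σ τ j fun x ↦
    (fun s' ↦ (G.nextState x s').toReal) ⬝ᵥ g) (G.integrable_comp_apply σ τ j fun x ↦ f x.1) ?_
  filter_upwards [G.ae_eq_entry σ τ j] with h hh
  have := H (fun i ↦ h i) (h j).1
  rwa [← hh] at this

end Play

/-! ### One-turn operators and value iteration -/

section Iteration

/-- The smallest average of `f` over the next state that the robbers can achieve by a move
in state `s`. -/
noncomputable def robVal (G : GPCR S Ac Ar) (f : S → ℝ) (s : S) : ℝ :=
  ⨅ b : G.RobAct s, G.Tr s b.1 ⬝ᵥ f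

/-- The guaranteed average of `f` after a turn that the cops begin with the action `a`
in state `s`. -/
noncomputable def turnVal (G : GPCR S Ac Ar) (f : S → ℝ) {s : S} (a : G.CopAct s) : ℝ :=
  G.Tc s a.1 ⬝ᵥ G.robVal f

/-- The largest guaranteed average of `f` after a turn that begins in state `s`. -/
noncomputable def copVal (G : GPCR S Ac Ar) (f : S → ℝ) (s : S) : ℝ :=
  ⨆ a : G.CopAct s, G.turnVal f a

/-- `G.valueIter k s` is the value of the game with `k` turns that starts in `s`. -/
noncomputable def valueIter (G : GPCR S Ac Ar) : ℕ → S → ℝ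
  | 0 => G.finalInd
  | k + 1 => G.copVal (G.valueIter k)

/-- `G.guarantee σ k s` is the probability of capture that the finite horizon strategy `σ` of the
cops guarantees in the game with `k` turns that starts in `s`. -/
noncomputable def guarantee (G : GPCR S Ac Ar) (σ : G.CopFiniteHorizon) : ℕ → S → ℝ
  | 0 => G.finalInd
  | k + 1 => fun s ↦ G.turnVal (G.guarantee σ k) (σ s (k + 1))

variable {G : GPCR S Ac Ar} {f g : S → ℝ} {s : S}

lemma exists_eq_robVal [Finite Ar] (G : GPCR S Ac Ar) (f : S → ℝ) (s : S) :
    ∃ b : G.RobAct s, G.Tr s b.1 ⬝ᵥ f = G.robVal f s :=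
  exists_eq_ciInf_of_finite

lemma robVal_le [Finite Ar] (f : S → ℝ) (b : G.RobAct s) : G.robVal f s ≤ G.Tr s b.1 ⬝ᵥ f :=
  ciInf_le (Set.finite_range _).bddBelow b

lemma exists_eq_copVal [Finite Ac] (G : GPCR S Ac Ar) (f : S → ℝ) (s : S) :
    ∃ a : G.CopAct s, G.turnVal f a = G.copVal f s :=
  exists_eq_ciSup_of_finite

lemma turnVal_le_copVal [Finite Ac] (f : S → ℝ) (a : G.CopAct s) : G.turnVal f a ≤ G.copVal f s :=
  le_ciSup (f := fun a : G.CopAct s ↦ G.turnVal f a) (Set.finite_range _).bddAbove a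

lemma turnVal_mono [Finite Ar] (h : f ≤ g) (a : G.CopAct s) : G.turnVal f a ≤ G.turnVal g a := by
  refine dotProduct_le_dotProduct_of_support (G.Tc_mem a) fun x _ ↦ ?_
  obtain ⟨b, hb⟩ := G.exists_eq_robVal g x
  rw [← hb]
  exact (robVal_le f b).trans (dotProduct_le_dotProduct_of_support (G.Tr_mem b) fun y _ ↦ h y)

lemma copVal_mono [Finite Ac] [Finite Ar] (h : f ≤ g) : G.copVal f ≤ G.copVal g := by
  intro s
  obtain ⟨a, ha⟩ := G.exists_eq_copVal f s
  rw [← ha]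
  exact (turnVal_mono h a).trans (turnVal_le_copVal g a)

lemma robVal_of_mem_final (hs : s ∈ G.final) (f : S → ℝ) : G.robVal f s = f s := by
  simp only [robVal, fun b : G.RobAct s ↦ dotProduct_eq_of_apply_eq_one (G.Tr_mem b)
    (G.isTransition_rob.absorbing s hs b.1) f, ciInf_const]

lemma turnVal_of_mem_final (hs : s ∈ G.final) (f : S → ℝ) (a : G.CopAct s) :
    G.turnVal f a = f s := by
  rw [turnVal, dotProduct_eq_of_apply_eq_one (G.Tc_mem a) (G.isTransition_cop.absorbing s hs a.1),
    robVal_of_mem_final hs]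

lemma le_turnVal_of_forall_le [Finite Ar] {c : ℝ} (h : ∀ s, c ≤ f s) (a : G.CopAct s) :
    c ≤ G.turnVal f a := by
  have hc (p : S → ℝ) (hp : p ∈ stdSimplex ℝ S) (k : S → ℝ) (hk : ∀ s, c ≤ k s) : c ≤ p ⬝ᵥ k :=
    (dotProduct_const_of_mem hp c).ge.trans
      (dotProduct_le_dotProduct_of_support hp fun s _ ↦ hk s)
  exact hc _ (G.Tc_mem a) _ fun x ↦ le_ciInf fun b ↦ hc _ (G.Tr_mem b) _ h

lemma turnVal_le_of_forall_le [Finite Ar] {c : ℝ} (h : ∀ s, f s ≤ c) (a : G.CopAct s) :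
    G.turnVal f a ≤ c := by
  refine dotProduct_le_of_support (G.Tc_mem a) fun x _ ↦ ?_
  obtain ⟨b, hb⟩ := G.exists_eq_robVal f x
  rw [← hb]
  exact dotProduct_le_of_support (G.Tr_mem b) fun y _ ↦ h y

lemma finalInd_of_mem (hs : s ∈ G.final) : G.finalInd s = 1 := Set.indicator_of_mem hs _

lemma finalInd_of_notMem (hs : s ∉ G.final) : G.finalInd s = 0 := Set.indicator_of_notMem hs _

lemma finalInd_nonneg (s : S) : 0 ≤ G.finalInd s := Set.indicator_nonneg (fun _ _ ↦ zero_le_one) s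

lemma finalInd_le_one (s : S) : G.finalInd s ≤ 1 :=
  Set.indicator_le_self' (fun _ _ ↦ zero_le_one) s

/-- The cops have a finite horizon strategy that is optimal for every horizon and start. -/
lemma exists_guarantee_eq_valueIter [Finite Ac] (G : GPCR S Ac Ar) :
    ∃ σ : G.CopFiniteHorizon, ∀ k, G.guarantee σ k = G.valueIter k := by
  -- With `k` turns remaining, the current one included, `k - 1` turns follow the current one.
  choose σ hσ using fun (s : S) (k : ℕ) ↦ G.exists_eq_copVal (G.valueIter (k - 1)) s
  refine ⟨σ, fun k ↦ ?_⟩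
  induction k with
  | zero => rfl
  | succ k ih =>
    ext s
    rw [guarantee, ih]
    exact hσ s (k + 1)

lemma guarantee_of_mem_final {σ : G.CopFiniteHorizon} (hs : s ∈ G.final) (k : ℕ) :
    G.guarantee σ k s = 1 := by
  induction k with
  | zero => exact finalInd_of_mem hs
  | succ k ih => exact (turnVal_of_mem_final hs _ _).trans ih

section Guarantee

variable [Finite Ar] {σ : G.CopFiniteHorizon}

lemma guarantee_mem_Icc (k : ℕ) (s : S) : G.guarantee σ k s ∈ Set.Icc 0 1 := by
  induction k generalizing s with
  | zero => exact ⟨finalInd_nonneg s, finalInd_le_one s⟩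
  | succ k ih =>
    exact ⟨le_turnVal_of_forall_le (fun s ↦ (ih s).1) _,
      turnVal_le_of_forall_le (fun s ↦ (ih s).2) _⟩

lemma guarantee_le_valueIter [Finite Ac] (k : ℕ) : G.guarantee σ k ≤ G.valueIter k := by
  induction k with
  | zero => exact le_rfl
  | succ k ih => exact fun s ↦ (turnVal_mono ih _).trans (turnVal_le_copVal _ _)

lemma valueIter_mem_Icc [Finite Ac] (k : ℕ) (s : S) : G.valueIter k s ∈ Set.Icc 0 1 := by
  obtain ⟨σ, hσ⟩ := G.exists_guarantee_eq_valueIter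
  rw [← hσ]
  exact guarantee_mem_Icc k s

lemma finalInd_le_turnVal (a : G.CopAct s) : G.finalInd s ≤ G.turnVal G.finalInd a := by
  by_cases hs : s ∈ G.final
  · rw [turnVal_of_mem_final hs]
  · rw [finalInd_of_notMem hs]
    exact le_turnVal_of_forall_le finalInd_nonneg a

/-- A memoryless strategy guarantees more, the longer the game. -/
lemma monotone_guarantee_memoryless (σ : G.CopMemoryless) :
    Monotone (G.guarantee fun s _ ↦ σ s) := by
  refine monotone_nat_of_le_succ fun k ↦ ?_
  induction k with
  | zero => exact fun s ↦ finalInd_le_turnVal (σ s)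
  | succ k ih => exact fun s ↦ turnVal_mono ih (σ s)

lemma monotone_valueIter [Finite Ac] (G : GPCR S Ac Ar) : Monotone G.valueIter := by
  refine monotone_nat_of_le_succ fun k ↦ ?_
  induction k with
  | zero =>
    intro s
    obtain ⟨a⟩ : Nonempty (G.CopAct s) := inferInstance
    exact (finalInd_le_turnVal a).trans (turnVal_le_copVal _ a)
  | succ k ih => exact copVal_mono ih

end Guarantee

lemma continuous_robVal [Finite Ar] (G : GPCR S Ac Ar) : Continuous G.robVal := by
  refine continuous_pi fun s ↦ ?_
  cases nonempty_fintype (G.RobAct s)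
  have h : (fun f ↦ G.robVal f s) = fun f ↦ Finset.univ.inf' Finset.univ_nonempty
      fun b : G.RobAct s ↦ G.Tr s b.1 ⬝ᵥ f :=
    funext fun f ↦ (Finset.inf'_univ_eq_ciInf _).symm
  rw [h]
  exact Continuous.finset_inf'_apply _ fun b _ ↦ continuous_const.dotProduct continuous_id

lemma continuous_turnVal [Finite Ar] (a : G.CopAct s) : Continuous fun f ↦ G.turnVal f a :=
  continuous_const.dotProduct G.continuous_robVal

lemma continuous_copVal [Finite Ac] [Finite Ar] (G : GPCR S Ac Ar) : Continuous G.copVal := by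
  refine continuous_pi fun s ↦ ?_
  cases nonempty_fintype (G.CopAct s)
  have h : (fun f ↦ G.copVal f s) = fun f ↦ Finset.univ.sup' Finset.univ_nonempty
      fun a : G.CopAct s ↦ G.turnVal f a :=
    funext fun f ↦ (Finset.sup'_univ_eq_ciSup _).symm
  rw [h]
  exact Continuous.finset_sup'_apply _ fun a _ ↦ continuous_turnVal a

/-- The limit of the values of the finite games, as a function of the starting state. (The supremum
is a limit because the values increase, and it is finite because they are at most `1`.) -/
noncomputable def valueLim (G : GPCR S Ac Ar) (s : S) : ℝ := ⨆ k, G.valueIter k s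

lemma tendsto_valueIter [Finite Ac] [Finite Ar] (G : GPCR S Ac Ar) :
    Tendsto G.valueIter atTop (𝓝 G.valueLim) :=
  tendsto_pi_nhds.2 fun s ↦ tendsto_atTop_ciSup (fun _ _ h ↦ G.monotone_valueIter h s)
    ⟨1, Set.forall_mem_range.2 fun k ↦ (valueIter_mem_Icc k s).2⟩

lemma valueIter_le_valueLim [Finite Ac] [Finite Ar] (k : ℕ) : G.valueIter k ≤ G.valueLim :=
  G.monotone_valueIter.ge_of_tendsto G.tendsto_valueIter k

lemma copVal_valueLim [Finite Ac] [Finite Ar] (G : GPCR S Ac Ar) :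
    G.copVal G.valueLim = G.valueLim :=
  tendsto_nhds_unique ((G.continuous_copVal.tendsto _).comp G.tendsto_valueIter)
    (G.tendsto_valueIter.comp (tendsto_add_atTop_nat 1))

lemma valueLim_of_mem_final [Finite Ac] [Finite Ar] (hs : s ∈ G.final) : G.valueLim s = 1 := by
  obtain ⟨σ, hσ⟩ := G.exists_guarantee_eq_valueIter
  simp [valueLim, ← hσ, guarantee_of_mem_final hs]

/-- What a memoryless strategy guarantees in the finite games converges to a fixed point of its
one-turn operator. -/
lemma exists_tendsto_guarantee_memoryless [Finite Ar] (σ : G.CopMemoryless) :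
    ∃ f : S → ℝ, Tendsto (G.guarantee fun s _ ↦ σ s) atTop (𝓝 f) ∧
      ∀ s, G.turnVal f (σ s) = f s := by
  have h : Tendsto (G.guarantee fun s _ ↦ σ s) atTop
      (𝓝 fun s ↦ ⨆ k, G.guarantee (fun s _ ↦ σ s) k s) :=
    tendsto_pi_nhds.2 fun s ↦ tendsto_atTop_ciSup
      (fun _ _ h ↦ monotone_guarantee_memoryless σ h s)
      ⟨1, Set.forall_mem_range.2 fun k ↦ (guarantee_mem_Icc k s).2⟩
  exact ⟨_, h, fun s ↦ tendsto_nhds_unique (((continuous_turnVal (σ s)).tendsto _).comp h)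
    ((tendsto_pi_nhds.1 h s).comp (tendsto_add_atTop_nat 1))⟩

/-! ### Bounds on the probability of capture -/

lemma extends_toGeneral (σ₀ : G.CopFiniteHorizon) (n : ℕ) : Extends (σ₀.toGeneral n) σ₀ n := by
  intro t _ past s
  simp [CopFiniteHorizon.toGeneral]

section Bounds

variable [Finite Ac] [Finite Ar] {σ : G.CopStrategy} {τ : G.RobStrategy}

/-- If the cops play at least as well as `f` demands, then `f` at the beginning of a turn is bounded
on average by `g` at its end, whatever the robbers do. -/
lemma le_expect_add_two (t : ℕ) (h : ∀ past s, f s ≤ G.turnVal g (σ (2 * t) past s)) :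
    G.expect σ τ (2 * t) f ≤ G.expect σ τ (2 * (t + 1)) g := by
  calc G.expect σ τ (2 * t) f ≤ G.expect σ τ (2 * t + 1) (G.robVal g) := by
        refine expect_le_expect_succ fun past s ↦ ?_
        rw [nextState_entry_of_even (by simp)]
        exact h past s
    _ ≤ _ := by
        refine expect_le_expect_succ fun past s ↦ ?_
        rw [nextState_entry_of_not_even (by simp)]
        exact robVal_le _ _

/-- If the robbers minimize the average of `g`, then `g` at the end of a turn is bounded on average
by any `f` that dominates the choices of the cops. -/
lemma expect_add_two_le (t : ℕ) (hσ : ∀ past s, G.turnVal g (σ (2 * t) past s) ≤ f s)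
    (hτ : ∀ past s, G.Tr s (τ (2 * t + 1) past s).1 ⬝ᵥ g ≤ G.robVal g s) :
    G.expect σ τ (2 * (t + 1)) g ≤ G.expect σ τ (2 * t) f := by
  calc G.expect σ τ (2 * (t + 1)) g ≤ G.expect σ τ (2 * t + 1) (G.robVal g) := by
        refine expect_succ_le_expect fun past s ↦ ?_
        rw [nextState_entry_of_not_even (by simp)]
        exact hτ past s
    _ ≤ _ := by
        refine expect_succ_le_expect fun past s ↦ ?_
        rw [nextState_entry_of_even (by simp)]
        exact hσ past s

/-- The robbers cannot beat the guarantee, even with strategies that depend on the history: the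
guarantee for the remaining turns is a submartingale along the play. -/
lemma guarantee_le_captureWithin {σ₀ : G.CopFiniteHorizon} {n : ℕ} (h : Extends σ σ₀ n)
    (τ : G.RobStrategy) : G.guarantee σ₀ n G.init ≤ G.captureWithin n σ τ := by
  have key : ∀ t ≤ n, G.guarantee σ₀ n G.init ≤
      G.expect σ τ (2 * t) (G.guarantee σ₀ (n - t)) := by
    intro t
    induction t with
    | zero => exact fun _ ↦ (expect_zero G σ τ _).ge
    | succ t ih =>
      refine fun ht ↦ (ih (by lia)).trans (le_expect_add_two t fun past s ↦ ?_)
      obtain ⟨m, hm⟩ : ∃ m, n - t = m + 1 := ⟨n - (t + 1), by lia⟩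
      rw [h t (by lia), hm, show n - (t + 1) = m by lia]
      exact le_rfl
  rw [captureWithin_eq_expect]
  simpa [guarantee] using key n le_rfl

/-- The robbers reach the guarantee by minimizing, in every turn, the guarantee for the turns that
remain after it. -/
lemma exists_captureWithin_le_guarantee (σ₀ : G.CopFiniteHorizon) :
    ∃ τ₀ : G.RobFiniteHorizon, ∀ n,
      G.captureWithin n (σ₀.toGeneral n) (τ₀.toGeneral n) ≤ G.guarantee σ₀ n G.init := by
  -- With `k` turns remaining, the current one included, `k - 1` turns follow the move.
  choose τ₀ hτ₀ using fun (s : S) (k : ℕ) ↦ G.exists_eq_robVal (G.guarantee σ₀ (k - 1)) s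
  refine ⟨τ₀, fun n ↦ ?_⟩
  have key : ∀ t ≤ n, G.expect (σ₀.toGeneral n) (RobFiniteHorizon.toGeneral τ₀ n) (2 * t)
      (G.guarantee σ₀ (n - t)) ≤ G.guarantee σ₀ n G.init := by
    intro t
    induction t with
    | zero => exact fun _ ↦ (expect_zero G _ _ _).le
    | succ t ih =>
      refine fun ht ↦ (expect_add_two_le t (fun past s ↦ ?_) fun past s ↦ ?_).trans (ih (by lia))
      · obtain ⟨m, hm⟩ : ∃ m, n - t = m + 1 := ⟨n - (t + 1), by lia⟩
        rw [extends_toGeneral σ₀ n t (by lia), hm, show n - (t + 1) = m by lia]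
        exact le_rfl
      · have h1 : n - (2 * t + 1) / 2 = n - t := by lia
        simp only [RobFiniteHorizon.toGeneral, h1]
        exact (hτ₀ s (n - t)).le
  rw [captureWithin_eq_expect]
  simpa [guarantee] using key n le_rfl

lemma captureWithin_mem_Icc (n : ℕ) : G.captureWithin n σ τ ∈ Set.Icc 0 1 :=
  ⟨measureReal_nonneg, measureReal_le_one⟩

lemma capture_mem_Icc : G.capture σ τ ∈ Set.Icc 0 1 :=
  ⟨measureReal_nonneg, measureReal_le_one⟩

lemma iInf_captureWithin (σ₀ : G.CopFiniteHorizon) (n : ℕ) :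
    ⨅ τ : G.RobFiniteHorizon, G.captureWithin n (σ₀.toGeneral n) (τ.toGeneral n) =
      G.guarantee σ₀ n G.init := by
  obtain ⟨τ₀, hτ₀⟩ := exists_captureWithin_le_guarantee σ₀
  exact le_antisymm
    (ciInf_le_of_le ⟨0, Set.forall_mem_range.2 fun _ ↦ (captureWithin_mem_Icc n).1⟩ τ₀ (hτ₀ n))
    (le_ciInf fun τ ↦ guarantee_le_captureWithin (extends_toGeneral σ₀ n) _)

lemma finiteValue_eq (G : GPCR S Ac Ar) (n : ℕ) : G.finiteValue n = G.valueIter n G.init := by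
  obtain ⟨σ, hσ⟩ := G.exists_guarantee_eq_valueIter
  simp only [finiteValue, iInf_captureWithin]
  refine le_antisymm (ciSup_le fun σ₀ ↦ guarantee_le_valueIter n _) ?_
  rw [← hσ]
  exact le_ciSup (f := fun σ₀ ↦ G.guarantee σ₀ n G.init)
    ⟨1, Set.forall_mem_range.2 fun _ ↦ (guarantee_mem_Icc n _).2⟩ σ

/-- A strategy that is optimal against finite horizon strategies is optimal against all. -/
lemma finiteValue_le_captureWithin_of_extends {σ₀ : G.CopFiniteHorizon} {n : ℕ}
    (hσ₀ : σ₀.IsOptimal n) (h : Extends σ σ₀ n) (τ : G.RobStrategy) :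
    G.finiteValue n ≤ G.captureWithin n σ τ := by
  rw [CopFiniteHorizon.IsOptimal] at hσ₀
  exact (le_ciInf hσ₀).trans ((iInf_captureWithin σ₀ n).trans_le (guarantee_le_captureWithin h τ))

/-- The robbers have a memoryless strategy against which the limit value never increases on
average, so that the probability of capture stays below its initial value. -/
lemma exists_capture_le_valueLim (G : GPCR S Ac Ar) :
    ∃ τ : G.RobMemoryless, ∀ σ : G.CopStrategy, G.capture σ τ.toGeneral ≤ G.valueLim G.init := by
  choose τ hτ using G.exists_eq_robVal G.valueLim
  refine ⟨τ, fun σ ↦ le_of_tendsto' (G.tendsto_captureWithin σ _) fun n ↦ ?_⟩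
  have key : G.expect σ (RobMemoryless.toGeneral τ) (2 * n) G.valueLim ≤ G.valueLim G.init := by
    induction n with
    | zero => exact (expect_zero G _ _ _).le
    | succ n ih =>
      refine (expect_add_two_le n (fun past s ↦ ?_) fun past s ↦ (hτ s).le).trans ih
      exact (turnVal_le_copVal _ _).trans_eq (congrFun G.copVal_valueLim s)
  rw [captureWithin_eq_expect]
  refine le_trans (integral_mono (G.integrable_comp_apply σ _ _ fun x ↦ G.finalInd x.1)
    (G.integrable_comp_apply σ _ _ fun x ↦ G.valueLim x.1) fun h ↦ ?_) key
  exact valueIter_le_valueLim 0 _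

end Bounds

end Iteration

/-! ### The attractor of the final states -/

/-- `G.attractor k` is the set of states from which an action that is optimal for the limit value
gives the cops a chance to reach a final state within `k` turns, whatever the robbers do. -/
def attractor (G : GPCR S Ac Ar) : ℕ → Set S
  | 0 => G.final
  | k + 1 => G.attractor k ∪ {s | ∃ a : G.CopAct s, G.turnVal G.valueLim a = G.valueLim s ∧
      ∃ s', 0 < G.Tc s a.1 s' ∧ ∀ b : G.RobAct s', ∃ s'' ∈ G.attractor k, 0 < G.Tr s' b.1 s''}

lemma monotone_attractor (G : GPCR S Ac Ar) : Monotone G.attractor :=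
  monotone_nat_of_le_succ fun _ ↦ Set.subset_union_left

/-- The attractor grows only finitely often. -/
lemma exists_attractor_subset (G : GPCR S Ac Ar) : ∃ K, ∀ k, G.attractor k ⊆ G.attractor K := by
  classical
  have h (s : S) : ∃ K, ∀ k, s ∈ G.attractor k → s ∈ G.attractor K := by
    by_cases hs : ∃ k, s ∈ G.attractor k
    · exact hs.imp fun K hK _ _ ↦ hK
    · exact ⟨0, fun k hk ↦ (hs ⟨k, hk⟩).elim⟩
  choose K hK using h
  exact ⟨Finset.univ.sup K, fun k s hs ↦
    G.monotone_attractor (Finset.le_sup (Finset.mem_univ s)) (hK s k hs)⟩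

variable [Finite Ac] [Finite Ar] {G : GPCR S Ac Ar}

/-- A state of positive value lies in the attractor. Otherwise the robbers could confine the play
to the states outside of the attractor of maximal value `m`, until the cops choose an action that
is not optimal; as there are finitely many of these actions, the values of all the finite games in
these states are bounded by a constant `m' < m`. -/
lemma exists_mem_attractor (s₀ : S) (h₀ : 0 < G.valueLim s₀) : ∃ k, s₀ ∈ G.attractor k := by
  obtain ⟨K, hK⟩ := G.exists_attractor_subset
  by_contra hcon
  push Not at hcon
  obtain ⟨s₁, hs₁, hmax⟩ := Set.exists_max_image (G.attractor K)ᶜ G.valueLim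
    (Set.toFinite _) ⟨s₀, hcon K⟩
  set m := G.valueLim s₁
  have hm0 : 0 < m := h₀.trans_le (hmax s₀ (hcon K))
  obtain ⟨m', hm'0, hm'm, hm'⟩ : ∃ m', 0 ≤ m' ∧ m' < m ∧
      ∀ x : Σ s, G.CopAct s, G.turnVal G.valueLim x.2 < m → G.turnVal G.valueLim x.2 ≤ m' := by
    have h1 : ∀ᶠ m' in 𝓝[<] m, ∀ x : Σ s, G.CopAct s,
        G.turnVal G.valueLim x.2 < m → G.turnVal G.valueLim x.2 ≤ m' := by
      refine eventually_all.2 fun x ↦ ?_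
      by_cases hx : G.turnVal G.valueLim x.2 < m
      · filter_upwards [Ioo_mem_nhdsLT hx] with y hy _ using hy.1.le
      · exact Eventually.of_forall fun _ h ↦ (hx h).elim
    obtain ⟨m', h2, h3⟩ := (h1.and (Ioo_mem_nhdsLT hm0)).exists
    exact ⟨m', h3.1.le, h3.2, h2⟩
  have key : ∀ k, ∀ s ∉ G.attractor K, G.valueLim s = m → G.valueIter k s ≤ m' := by
    intro k
    induction k with
    | zero =>
      intro s hs _
      exact (finalInd_of_notMem fun h ↦ hs (hK 0 h)).trans_le hm'0
    | succ k ih =>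
      intro s hs hsm
      obtain ⟨a, ha⟩ := G.exists_eq_copVal (G.valueIter k) s
      have hle : G.turnVal G.valueLim a ≤ m :=
        (turnVal_le_copVal _ a).trans_eq ((congrFun G.copVal_valueLim s).trans hsm)
      change G.copVal (G.valueIter k) s ≤ m'
      rw [← ha]
      rcases hle.lt_or_eq with hlt | heq
      · exact (turnVal_mono (valueIter_le_valueLim k) a).trans (hm' ⟨s, a⟩ hlt)
      -- The answers `b` of the robbers to an optimal action stay outside of the attractor.
      have hb : ∀ s', 0 < G.Tc s a.1 s' →
          ∃ b : G.RobAct s', ∀ s'', 0 < G.Tr s' b.1 s'' → s'' ∉ G.attractor K := by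
        by_contra! h
        obtain ⟨s', hs', h⟩ := h
        refine hs (hK (K + 1) (Or.inr ⟨a, heq.trans hsm.symm, s', hs', fun b ↦ ?_⟩))
        obtain ⟨s'', h1, h2⟩ := h b
        exact ⟨s'', h2, h1⟩
      have hrob : ∀ s', 0 < G.Tc s a.1 s' → G.robVal G.valueLim s' ≤ m := by
        intro s' hs'
        obtain ⟨b, hb⟩ := hb s' hs'
        exact (robVal_le _ b).trans
          (dotProduct_le_of_support (G.Tr_mem b) fun s'' h ↦ hmax s'' (hb s'' h))
      refine dotProduct_le_of_support (G.Tc_mem a) fun s' hs' ↦ ?_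
      obtain ⟨b, hb⟩ := hb s' hs'
      -- As the average over `s'` is `m`, the bound `m` is attained at each `s'`, and then also at
      -- each state `s''` that can follow, so that the induction hypothesis applies to `s''`.
      have hmb : m ≤ G.Tr s' b.1 ⬝ᵥ G.valueLim := by
        refine le_trans ?_ (robVal_le _ b)
        by_contra! hlt
        exact (dotProduct_lt_of_support (G.Tc_mem a) hrob hs' hlt).ne heq
      refine (robVal_le _ b).trans
        (dotProduct_le_of_support (G.Tr_mem b) fun s'' hs'' ↦ ih s'' (hb s'' hs'') ?_)
      by_contra hne
      exact hmb.not_gt (dotProduct_lt_of_support (G.Tr_mem b) (fun y hy ↦ hmax y (hb y hy)) hs''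
        ((hmax s'' (hb s'' hs'')).lt_of_ne hne))
  exact hm'm.not_ge (le_of_tendsto' (tendsto_pi_nhds.1 G.tendsto_valueIter s₁)
    fun k ↦ key k s₁ hs₁ rfl)

/-! ### Optimal memoryless strategies -/

/-- The cops have a memoryless strategy that is optimal for the limit value and that gives them a
chance to move down in the attractor. -/
lemma exists_attracting_strategy (G : GPCR S Ac Ar) :
    ∃ σ : G.CopMemoryless, (∀ s, G.turnVal G.valueLim (σ s) = G.valueLim s) ∧
      ∀ k s, s ∈ G.attractor (k + 1) → s ∉ G.attractor k →
        ∃ s', 0 < G.Tc s (σ s).1 s' ∧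
          ∀ b : G.RobAct s', ∃ s'' ∈ G.attractor k, 0 < G.Tr s' b.1 s'' := by
  have h (s : S) : ∃ a : G.CopAct s, G.turnVal G.valueLim a = G.valueLim s ∧
      ∀ k, s ∈ G.attractor (k + 1) → s ∉ G.attractor k →
        ∃ s', 0 < G.Tc s a.1 s' ∧
          ∀ b : G.RobAct s', ∃ s'' ∈ G.attractor k, 0 < G.Tr s' b.1 s'' := by
    by_cases hs : ∃ k, s ∈ G.attractor (k + 1) ∧ s ∉ G.attractor k
    · obtain ⟨k, h1, h2⟩ := hs
      obtain ⟨a, ha, hs'⟩ := h1.resolve_left h2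
      refine ⟨a, ha, fun l h3 h4 ↦ ?_⟩
      obtain rfl : k = l := by
        by_contra hne
        rcases Nat.lt_or_gt_of_ne hne with hlt | hlt
        · exact h4 (G.monotone_attractor hlt h1)
        · exact h2 (G.monotone_attractor hlt h3)
      exact hs'
    · obtain ⟨a, ha⟩ := G.exists_eq_copVal G.valueLim s
      exact ⟨a, ha.trans (congrFun G.copVal_valueLim s), fun k h1 h2 ↦ (hs ⟨k, h1, h2⟩).elim⟩
  choose σ hσ using h
  exact ⟨σ, fun s ↦ (hσ s).1, fun k s ↦ (hσ s).2 k⟩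

/-- The cops have a memoryless strategy that guarantees the limit value. For an attracting strategy,
the states in which the guaranteed probability falls short of the limit value by the maximal
amount `D` are closed under the answers of the robbers that minimize the guarantee. If `D` were
positive, these states would lie in the attractor, and the play would have a chance to move down
to a final state, where nothing is missing. -/
lemma exists_valueLim_le_capture (G : GPCR S Ac Ar) :
    ∃ σ : G.CopMemoryless, ∀ τ : G.RobStrategy, G.valueLim G.init ≤ G.capture σ.toGeneral τ := by
  obtain ⟨σ, hopt, hatt⟩ := G.exists_attracting_strategy
  obtain ⟨f, hf, hfix⟩ := exists_tendsto_guarantee_memoryless σ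
  have hf' := tendsto_pi_nhds.1 hf
  have hle (s : S) : G.valueLim s ≤ f s := by
    have : Nonempty S := ⟨s⟩
    obtain ⟨s₁, hmax⟩ := Finite.exists_max fun s ↦ G.valueLim s - f s
    set D := G.valueLim s₁ - f s₁
    by_contra! hlt
    have hD0 : 0 < D := (sub_pos.2 hlt).trans_le (hmax s)
    have hf0 : 0 ≤ f s₁ := ge_of_tendsto' (hf' s₁) fun k ↦ (guarantee_mem_Icc k s₁).1
    -- What is missing after a move of the cops is at most what is missing on average after an
    -- answer of the robbers that minimizes the guarantee.
    have hrob (x : S) (b : G.RobAct x) (hb : G.Tr x b.1 ⬝ᵥ f = G.robVal f x) :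
        G.robVal G.valueLim x - G.robVal f x ≤ G.Tr x b.1 ⬝ᵥ (G.valueLim - f) := by
      rw [dotProduct_sub, hb]
      exact sub_le_sub_right (robVal_le _ b) _
    have key : ∀ k, ∀ x ∈ G.attractor k, G.valueLim x - f x < D := by
      intro k
      induction k with
      | zero =>
        intro x hx
        rwa [valueLim_of_mem_final hx, tendsto_nhds_unique (hf' x)
          (by simp only [guarantee_of_mem_final (show x ∈ G.final from hx)]
              exact tendsto_const_nhds), sub_self]
      | succ k ih =>
        intro x hx
        by_cases hxk : x ∈ G.attractor k
        · exact ih x hxk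
        obtain ⟨y, hy, hyb⟩ := hatt k x hx hxk
        rw [← hopt x, ← hfix x, turnVal, turnVal, ← dotProduct_sub]
        refine dotProduct_lt_of_support (G.Tc_mem _) (fun z _ ↦ ?_) hy ?_
        · obtain ⟨b, hb⟩ := G.exists_eq_robVal f z
          exact (hrob z b hb).trans (dotProduct_le_of_support (G.Tr_mem b) fun u _ ↦ hmax u)
        · obtain ⟨b, hb⟩ := G.exists_eq_robVal f y
          obtain ⟨u, huk, hu⟩ := hyb b
          exact (hrob y b hb).trans_lt
            (dotProduct_lt_of_support (G.Tr_mem b) (fun u _ ↦ hmax u) hu (ih u huk))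
    obtain ⟨k, hk⟩ := exists_mem_attractor s₁ (hD0.trans_le (sub_le_self _ hf0))
    exact (key k s₁ hk).false
  refine ⟨σ, fun τ ↦ (hle _).trans (le_of_tendsto' (hf' G.init) fun n ↦ ?_)⟩
  exact (guarantee_le_captureWithin (σ := CopMemoryless.toGeneral σ) (fun _ _ _ _ ↦ rfl) τ).trans
    (G.captureWithin_le_capture _ τ n)

/-- A saddle point `(a₀, b₀)`, which guarantees `v` to either player, determines the max-min and the
min-max value. The bounds on `u` make the real-valued suprema and infima meaningful. -/
lemma ciSup_ciInf_eq_and_ciInf_ciSup_eq {α β : Type*} {u : α → β → ℝ} {v : ℝ}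
    (hu : ∀ a b, u a b ∈ Set.Icc 0 1) {a₀ : α} (ha₀ : ∀ b, v ≤ u a₀ b) {b₀ : β}
    (hb₀ : ∀ a, u a b₀ ≤ v) : ⨆ a, ⨅ b, u a b = v ∧ ⨅ b, ⨆ a, u a b = v := by
  have : Nonempty α := ⟨a₀⟩
  have : Nonempty β := ⟨b₀⟩
  have hbelow (a : α) : BddBelow (Set.range (u a)) := ⟨0, Set.forall_mem_range.2 fun b ↦ (hu a b).1⟩
  have habove (b : β) : BddAbove (Set.range fun a ↦ u a b) :=
    ⟨1, Set.forall_mem_range.2 fun a ↦ (hu a b).2⟩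
  have h1 (a : α) : ⨅ b, u a b ≤ v := ciInf_le_of_le (hbelow a) b₀ (hb₀ a)
  have h2 (b : β) : v ≤ ⨆ a, u a b := le_ciSup_of_le (habove b) a₀ (ha₀ b)
  exact ⟨le_antisymm (ciSup_le h1)
      (le_ciSup_of_le ⟨v, Set.forall_mem_range.2 h1⟩ a₀ (le_ciInf ha₀)),
    le_antisymm (ciInf_le_of_le ⟨v, Set.forall_mem_range.2 h2⟩ b₀ (ciSup_le hb₀)) (le_ciInf h2)⟩

end GPCR

theorem mainTheorem2 {S Ac Ar : Type*} [Fintype S] [Finite Ac] [Finite Ar] (G : GPCR S Ac Ar) :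
    -- the infinite game has the value `G.value`, in memoryless and in general strategies
    ((⨅ τ : G.RobMemoryless, ⨆ σ : G.CopMemoryless, G.capture σ.toGeneral τ.toGeneral) = G.value ∧
      (⨆ σ : G.CopStrategy, ⨅ τ : G.RobStrategy, G.capture σ τ) = G.value ∧
      (⨅ τ : G.RobStrategy, ⨆ σ : G.CopStrategy, G.capture σ τ) = G.value) ∧
    -- which is the limit of the values of the finite games
    Tendsto G.finiteValue atTop (𝓝 G.value) ∧
    -- and optimal strategies of the cops in the `n`-turn game are `ε`-optimal for large `n`
    (∀ ε : ℝ, 0 < ε → ∃ N : ℕ, ∀ n ≥ N,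
      (∀ σ₀ : G.CopFiniteHorizon, σ₀.IsOptimal n →
        ∀ σ : G.CopStrategy, GPCR.Extends σ σ₀ n → G.IsEpsOptimal ε σ) ∧
      (∀ σ : G.CopStrategy, G.IsOptimalWithin n σ → G.IsEpsOptimal ε σ)) := by
  obtain ⟨σ₁, hσ₁⟩ := G.exists_valueLim_le_capture
  obtain ⟨τ₁, hτ₁⟩ := G.exists_capture_le_valueLim
  obtain ⟨hv, hmin⟩ := GPCR.ciSup_ciInf_eq_and_ciInf_ciSup_eq
    (u := fun (σ : G.CopMemoryless) (τ : G.RobMemoryless) ↦ G.capture σ.toGeneral τ.toGeneral)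
    (fun _ _ ↦ GPCR.capture_mem_Icc) (fun τ ↦ hσ₁ τ.toGeneral) fun σ ↦ hτ₁ σ.toGeneral
  obtain ⟨hsup, hinf⟩ := GPCR.ciSup_ciInf_eq_and_ciInf_ciSup_eq (u := G.capture)
    (fun _ _ ↦ GPCR.capture_mem_Icc) hσ₁ hτ₁
  have hv : G.value = G.valueLim G.init := hv
  have hlim : Tendsto G.finiteValue atTop (𝓝 G.value) := by
    rw [hv, funext G.finiteValue_eq]
    exact tendsto_pi_nhds.1 G.tendsto_valueIter G.init
  refine ⟨⟨hmin.trans hv.symm, hsup.trans hv.symm, hinf.trans hv.symm⟩, hlim, fun ε hε ↦ ?_⟩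
  obtain ⟨N, hN⟩ := eventually_atTop.1 (hlim.eventually_const_le (sub_lt_self G.value hε))
  exact ⟨N, fun n hn ↦ ⟨fun σ₀ hσ₀ σ hσ τ ↦ (hN n hn).trans
      ((GPCR.finiteValue_le_captureWithin_of_extends hσ₀ hσ τ).trans
        (G.captureWithin_le_capture σ τ n)),
    fun σ hσ τ ↦ (hN n hn).trans ((hσ τ).trans (G.captureWithin_le_capture σ τ n))⟩⟩
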